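/- Let $\mathfrak H$ be a complex Hilbert space and let $A,B$ be bounded linear operators on $\mathfrak H$ with $A^*A+B^*B=\mathrm{id}_{\mathfrak H}$ (a Pythagorean pair). Assume that $(A,B)$ is diffuse: for every sequence $(x_k)_{k\ge 1}$ with each $x_k\in\{A,B\}$ and every $\xi\in\mathfrak H$ one has $\lim_{n\to\infty}x_n\cdots x_2x_1\xi=0$. A tree is a finite rooted binary tree in which every vertex has two children (left and right) or none; its leaves are numbered from left to right and identified with finite words in $\{0,1\}$ (the paths from the root, $0$ for left and $1$ for right). Thompson's group $F$ is the group of homeomorphisms $g$ of the Cantor space $\{0,1\}^{\mathbf N}$ for which there is a pair $(t,s)$ of trees with the same number $n$ of leaves, with leaf words $\nu_1,\dots,\nu_n$ and $\omega_1,\dots,\omega_n$ respectively, such that $g(\omega_k x)=\nu_k x$ for all $1\le k\le n$ and all $x\in\{0,1\}^{\mathbf N}$; one then writes $g=[t,s]$. For a tree $t$ let $\mathfrak H_t=\bigoplus_{\ell}\mathfrak H$ be the Hilbert space of decorations of the leaves of $t$ by vectors of $\mathfrak H$. If $t'$ is obtained from $t$ by attaching two children at the leaf $\ell$, let $\mathfrak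 H_t\to\mathfrak H_{t'}$ be the isometry which replaces the decoration $\xi_\ell$ by $A\xi_\ell$ at the left child and $B\xi_\ell$ at the right child and keeps all other decorations. Let $\mathscr H$ be the completion of the direct limit of these spaces over all trees, write $[t,\xi]\in\mathscr H$ for the class of $\xi\in\mathfrak H_t$, and let $\sigma:F\curvearrowright\mathscr H$ be the Pythagorean representation of $(A,B)$: the unitary representation determined by $\sigma([t,s])[s,\xi]=[t,\xi]$, where the decoration of the $k$-th leaf of $s$ is moved to the $k$-th leaf of $t$. Then $\sigma$ is Ind-mixing: for every non-trivial subgroup $K\subset F$ and every finite-dimensional non-zero unitary representation $\theta:K\curvearrowright\mathfrak K$, the induced representation $\mathrm{Ind}_K^F\theta$, acting on $\ell^2(F/K,\mathfrak K)$, is not contained in $\sigma$, i.e. it is not unitarily equivalent to the restriction of $\sigma$ to a closed $F$-invariant subspace of $\mathscr H$. -/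

import Mathlib

/-- Finite rooted binary trees in which every vertex has two children or none. -/
inductive BinTree : Type
  | leaf : BinTree
  | node (l r : BinTree) : BinTree

namespace BinTree

/-- The leaves of a tree. -/
inductive Leaf : BinTree → Type
  | root : Leaf leaf
  | left {l r : BinTree} (i : Leaf l) : Leaf (node l r)
  | right {l r : BinTree} (j : Leaf r) : Leaf (node l r)

/-- The leaves of `node l r` are the leaves of `l` and those of `r`. -/
def leafSumEquiv (l r : BinTree) : l.Leaf ⊕ r.Leaf ≃ (node l r).Leaf where
  toFun := Sum.elim .left .right
  invFun
    | .left i => .inl i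
    | .right j => .inr j
  left_inv x := by cases x <;> rfl
  right_inv x := by cases x <;> rfl

instance : Unique leaf.Leaf where
  default := .root
  uniq := fun .root => rfl

instance instFintypeLeaf : (t : BinTree) → Fintype t.Leaf
  | leaf => inferInstance
  | node l r =>
    letI := instFintypeLeaf l
    letI := instFintypeLeaf r
    Fintype.ofEquiv _ (leafSumEquiv l r)

theorem sum_leaf {M : Type*} [AddCommMonoid M] (f : leaf.Leaf → M) : ∑ i, f i = f .root :=
  Fintype.sum_unique f

theorem sum_node {M : Type*} [AddCommMonoid M] {l r : BinTree} (f : (node l r).Leaf → M) :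
    ∑ i, f i = ∑ i, f (.left i) + ∑ j, f (.right j) := by
  rw [← (leafSumEquiv l r).sum_comp, Fintype.sum_sum_type]
  rfl

/-- The number of leaves. -/
def numLeaves : BinTree → ℕ
  | leaf => 1
  | node l r => numLeaves l + numLeaves r

/-- The position of a leaf when the leaves are numbered from left to right, starting with `0`. -/
def pos : (t : BinTree) → t.Leaf → ℕ
  | leaf, .root => 0
  | node l _, .left i => pos l i
  | node l r, .right j => numLeaves l + pos r j

theorem pos_lt : (t : BinTree) → (i : t.Leaf) → pos t i < numLeaves t
  | leaf, .root => Nat.one_pos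
  | node l _, .left i => Nat.lt_add_right _ (pos_lt l i)
  | node _ r, .right j => Nat.add_lt_add_left (pos_lt r j) _

theorem pos_injective : (t : BinTree) → Function.Injective (pos t)
  | leaf, .root, .root, _ => rfl
  | node l _, .left _, .left _, h => congrArg Leaf.left (pos_injective l h)
  | node _ r, .right _, .right _, h => congrArg Leaf.right (pos_injective r (Nat.add_left_cancel h))
  | node l _, .left i, .right j, h => by
    have h1 := pos_lt l i
    simp only [pos] at h
    omega
  | node l _, .right j, .left i, h => by
    have h1 := pos_lt l i
    simp only [pos] at h
    omega

/-- Leaves are ordered from left to right. -/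
noncomputable instance (t : BinTree) : LinearOrder t.Leaf :=
  LinearOrder.lift' (pos t) (pos_injective t)

theorem leaf_lt_iff {t : BinTree} {i j : t.Leaf} : i < j ↔ pos t i < pos t j := Iff.rfl

/-- The binary word (`false` for a left edge, `true` for a right edge) that describes the path
from the root to a leaf. -/
def word : (t : BinTree) → t.Leaf → List Bool
  | leaf, .root => []
  | node l _, .left i => false :: word l i
  | node _ r, .right j => true :: word r j

/-- `t ≤ s` means that `t` is a rooted subtree of `s`. -/
protected def le : BinTree → BinTree → Prop
  | leaf, _ => True
  | node _ _, leaf => False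
  | node l r, node l' r' => BinTree.le l l' ∧ BinTree.le r r'

protected theorem le_refl : (t : BinTree) → BinTree.le t t
  | leaf => trivial
  | node l r => ⟨BinTree.le_refl l, BinTree.le_refl r⟩

protected theorem le_trans : (t s r : BinTree) → BinTree.le t s → BinTree.le s r → BinTree.le t r
  | leaf, _, _, _, _ => trivial
  | node _ _, node _ _, node _ _, h, h' =>
    ⟨BinTree.le_trans _ _ _ h.1 h'.1, BinTree.le_trans _ _ _ h.2 h'.2⟩

protected theorem le_antisymm : (t s : BinTree) → BinTree.le t s → BinTree.le s t → t = s
  | leaf, leaf, _, _ => rfl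
  | node _ _, node _ _, h, h' => by
    rw [BinTree.le_antisymm _ _ h.1 h'.1, BinTree.le_antisymm _ _ h.2 h'.2]

instance : PartialOrder BinTree where
  le := BinTree.le
  le_refl := BinTree.le_refl
  le_trans := BinTree.le_trans
  le_antisymm := BinTree.le_antisymm

/-- The union of two trees, seen as rooted subtrees of the infinite binary tree. -/
def union : BinTree → BinTree → BinTree
  | leaf, s => s
  | t, leaf => t
  | node l r, node l' r' => node (union l l') (union r r')

theorem le_union_left : (t s : BinTree) → t ≤ union t s
  | leaf, _ => trivial
  | node l r, leaf => le_refl (node l r)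
  | node l r, node l' r' => ⟨le_union_left l l', le_union_left r r'⟩

theorem le_union_right : (t s : BinTree) → s ≤ union t s
  | leaf, s => le_refl s
  | node _ _, leaf => trivial
  | node l r, node l' r' => ⟨le_union_right l l', le_union_right r r'⟩

instance : IsDirectedOrder BinTree :=
  ⟨fun t s => ⟨union t s, le_union_left t s, le_union_right t s⟩⟩

instance : Nonempty BinTree := ⟨leaf⟩

/-- Grafting: attach the tree `f i` at the leaf `i` of `t` (composition of `t` with a forest). -/
def graft : (t : BinTree) → (t.Leaf → BinTree) → BinTree
  | leaf, f => f .root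
  | node l r, f => node (graft l fun i => f (.left i)) (graft r fun j => f (.right j))

/-- The leaf of `graft t f` that is the leaf `j` of the tree attached at the leaf `i`. -/
def graftLeaf : (t : BinTree) → (f : t.Leaf → BinTree) → (i : t.Leaf) → (f i).Leaf →
    (graft t f).Leaf
  | leaf, _, .root, j => j
  | node l _, f, .left i, j => .left (graftLeaf l (fun i => f (.left i)) i j)
  | node _ r, f, .right i, j => .right (graftLeaf r (fun i => f (.right i)) i j)

theorem le_graft : (t : BinTree) → (f : t.Leaf → BinTree) → t ≤ graft t f
  | leaf, _ => trivial
  | node l r, _ => ⟨le_graft l _, le_graft r _⟩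

theorem exists_eq_graft : (t s : BinTree) → t ≤ s → ∃ f, s = graft t f
  | leaf, s, _ => ⟨fun _ => s, rfl⟩
  | node l r, node l' r', h => by
    obtain ⟨f, hf⟩ := exists_eq_graft l l' h.1
    obtain ⟨g, hg⟩ := exists_eq_graft r r' h.2
    exact ⟨fun | .left i => f i | .right j => g j, by rw [hf, hg]; rfl⟩

theorem word_graftLeaf : (t : BinTree) → (f : t.Leaf → BinTree) → (i : t.Leaf) →
    (j : (f i).Leaf) → word _ (graftLeaf t f i j) = word t i ++ word (f i) j
  | leaf, _, .root, _ => rfl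
  | node l _, f, .left i, j => congrArg (false :: ·) (word_graftLeaf l (fun i => f (.left i)) i j)
  | node _ r, f, .right i, j => congrArg (true :: ·) (word_graftLeaf r (fun i => f (.right i)) i j)

theorem graftLeaf_surjective : (t : BinTree) → (f : t.Leaf → BinTree) → (k : (graft t f).Leaf) →
    ∃ i j, graftLeaf t f i j = k
  | leaf, _, k => ⟨.root, k, rfl⟩
  | node l _, f, .left k => by
    obtain ⟨i, j, rfl⟩ := graftLeaf_surjective l (fun i => f (.left i)) k
    exact ⟨.left i, j, rfl⟩
  | node _ r, f, .right k => by
    obtain ⟨i, j, rfl⟩ := graftLeaf_surjective r (fun i => f (.right i)) k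
    exact ⟨.right i, j, rfl⟩

theorem pos_graftLeaf_lt : (t : BinTree) → (f : t.Leaf → BinTree) → (i : t.Leaf) →
    (j j' : (f i).Leaf) → pos _ j < pos _ j' →
    pos _ (graftLeaf t f i j) < pos _ (graftLeaf t f i j')
  | leaf, _, .root, _, _, h => h
  | node l _, f, .left i, j, j', h => pos_graftLeaf_lt l (fun i => f (.left i)) i j j' h
  | node _ r, f, .right i, j, j', h =>
    Nat.add_lt_add_left (pos_graftLeaf_lt r (fun i => f (.right i)) i j j' h) _

theorem pos_graftLeaf_lt' : (t : BinTree) → (f : t.Leaf → BinTree) → (i i' : t.Leaf) →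
    (j : (f i).Leaf) → (j' : (f i').Leaf) → pos _ i < pos _ i' →
    pos _ (graftLeaf t f i j) < pos _ (graftLeaf t f i' j')
  | leaf, _, .root, .root, _, _, h => absurd h (lt_irrefl _)
  | node l _, f, .left i, .left i', j, j', h =>
    pos_graftLeaf_lt' l (fun i => f (.left i)) i i' j j' h
  | node l r, f, .right i, .right i', j, j', h =>
    Nat.add_lt_add_left (pos_graftLeaf_lt' r (fun i => f (.right i)) i i' j j'
      (Nat.lt_of_add_lt_add_left h)) _
  | node l r, f, .left i, .right i', j, j', _ =>
    Nat.lt_add_right _ (pos_lt _ (graftLeaf l (fun i => f (.left i)) i j))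
  | node l r, f, .right i, .left i', j, j', h => by
    have h1 := pos_lt l i'
    simp only [pos] at h
    omega

theorem graftLeaf_lt {t : BinTree} {f : t.Leaf → BinTree} {i : t.Leaf}
    {j j' : (f i).Leaf} (h : j < j') : graftLeaf t f i j < graftLeaf t f i j' :=
  pos_graftLeaf_lt t f i j j' h

theorem graftLeaf_lt' {t : BinTree} {f : t.Leaf → BinTree} {i i' : t.Leaf} (j : (f i).Leaf)
    (j' : (f i').Leaf) (h : i < i') : graftLeaf t f i j < graftLeaf t f i' j' :=
  pos_graftLeaf_lt' t f i i' j j' h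

/-- Two trees with the same leaf words coincide. -/
theorem eq_of_word : (t s : BinTree) → (a : t.Leaf → s.Leaf) → (b : s.Leaf → t.Leaf) →
    (∀ i, word s (a i) = word t i) → (∀ j, word t (b j) = word s j) → t = s := by
  have nonempty : ∀ t : BinTree, Nonempty t.Leaf := by
    intro t
    induction t with
    | leaf => exact ⟨.root⟩
    | node l r hl _ => exact ⟨.left hl.some⟩
  intro t
  induction t with
  | leaf =>
    intro s a b ha hb
    cases s with
    | leaf => rfl
    | node l r =>
      exfalso
      have := ha .root
      rcases h : a .root with i | i <;> rw [h] at this <;> simp [word] at this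
  | node l r hl hr =>
    intro s a b ha hb
    cases s with
    | leaf =>
      exfalso
      have := hb .root
      rcases h : b .root with i | i <;> rw [h] at this <;> simp [word] at this
    | node l' r' =>
      have key : ∀ (t s : BinTree), (∀ i, ∃ j, word s j = word t i) →
          (∀ j, ∃ i, word t i = word s j) →
          ∃ (a : t.Leaf → s.Leaf) (b : s.Leaf → t.Leaf),
            (∀ i, word s (a i) = word t i) ∧ (∀ j, word t (b j) = word s j) := by
        intro t s h1 h2
        choose a ha using h1
        choose b hb using h2
        exact ⟨a, b, ha, hb⟩
      have e1 : l = l' := by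
        obtain ⟨a', b', ha', hb'⟩ := key l l'
          (fun i => by
            have := ha (.left i)
            cases h : a (.left i) with
            | left k => exact ⟨k, by simpa [h, word] using this⟩
            | right k => simp [h, word] at this)
          (fun i => by
            have := hb (.left i)
            cases h : b (.left i) with
            | left k => exact ⟨k, by simpa [h, word] using this⟩
            | right k => simp [h, word] at this)
        exact hl _ a' b' ha' hb'
      have e2 : r = r' := by
        obtain ⟨a', b', ha', hb'⟩ := key r r'
          (fun i => by
            have := ha (.right i)
            cases h : a (.right i) with
            | right k => exact ⟨k, by simpa [h, word] using this⟩
            | left k => simp [h, word] at this)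
          (fun i => by
            have := hb (.right i)
            cases h : b (.right i) with
            | right k => exact ⟨k, by simpa [h, word] using this⟩
            | left k => simp [h, word] at this)
        exact hr _ a' b' ha' hb'
      rw [e1, e2]

theorem word_injective : (t : BinTree) → Function.Injective (word t)
  | leaf, .root, .root, _ => rfl
  | node l _, .left _, .left _, h => congrArg Leaf.left (word_injective l (List.cons_inj_right _ |>.1 h))
  | node _ r, .right _, .right _, h => congrArg Leaf.right (word_injective r (List.cons_inj_right _ |>.1 h))
  | node l _, .left i, .right j, h => by simp [word] at h
  | node l _, .right j, .left i, h => by simp [word] at h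

end BinTree

namespace BinTree

theorem graftLeaf_inj {t : BinTree} {f : t.Leaf → BinTree} {i i' : t.Leaf} {j : (f i).Leaf}
    {j' : (f i').Leaf} (h : graftLeaf t f i j = graftLeaf t f i' j') :
    (⟨i, j⟩ : Σ i, (f i).Leaf) = ⟨i', j'⟩ := by
  rcases lt_trichotomy i i' with hi | rfl | hi
  · exact absurd h (graftLeaf_lt' j j' hi).ne
  · rcases lt_trichotomy j j' with hj | rfl | hj
    · exact absurd h (graftLeaf_lt hj).ne
    · rfl
    · exact absurd h (graftLeaf_lt hj).ne'
  · exact absurd h (graftLeaf_lt' j' j hi).ne'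

/-- An order isomorphism between the leaves of two trees extends to the leaves of the trees
obtained by grafting the same trees at corresponding leaves. -/
theorem exists_graftIso {t s : BinTree} (e : s.Leaf ≃o t.Leaf) (f : t.Leaf → BinTree) :
    ∃ e' : (graft s (fun i => f (e i))).Leaf ≃o (graft t f).Leaf,
      ∀ i j, e' (graftLeaf s (fun i => f (e i)) i j) = graftLeaf t f (e i) j := by
  choose a b hab using graftLeaf_surjective s (fun i => f (e i))
  let φ : (graft s (fun i => f (e i))).Leaf → (graft t f).Leaf :=
    fun k => graftLeaf t f (e (a k)) (b k)
  have hφ : ∀ i j, φ (graftLeaf s (fun i => f (e i)) i j) = graftLeaf t f (e i) j := by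
    intro i j
    have h := graftLeaf_inj (hab (graftLeaf s (fun i => f (e i)) i j))
    exact congrArg (fun x : Σ i, (f (e i)).Leaf => graftLeaf t f (e x.1) x.2) h
  have hmono : StrictMono φ := by
    intro k k' hk
    obtain ⟨i, j, rfl⟩ := graftLeaf_surjective s (fun i => f (e i)) k
    obtain ⟨i', j', rfl⟩ := graftLeaf_surjective s (fun i => f (e i)) k'
    rw [hφ, hφ]
    rcases lt_trichotomy i i' with hi | rfl | hi
    · exact graftLeaf_lt' j j' (e.lt_iff_lt.2 hi)
    · rcases lt_trichotomy j j' with hj | rfl | hj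
      · exact graftLeaf_lt hj
      · exact absurd hk (lt_irrefl _)
      · have h := graftLeaf_lt (t := s) (f := fun i => f (e i)) hj
        exact absurd h hk.not_gt
    · have h := graftLeaf_lt' (t := s) (f := fun i => f (e i)) j' j hi
      exact absurd h hk.not_gt
  have hsurj : Function.Surjective φ := by
    intro k
    obtain ⟨i, j, rfl⟩ := graftLeaf_surjective t f k
    obtain ⟨i, rfl⟩ := e.surjective i
    exact ⟨_, hφ i j⟩
  exact ⟨hmono.orderIsoOfSurjective φ hsurj, hφ⟩

end BinTree

/-- The Cantor space of infinite binary sequences, with the product topology. -/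
abbrev Cantor : Type := ℕ → Bool

/-- Concatenation of a finite binary word with an infinite binary sequence. -/
def prepend : List Bool → Cantor → Cantor
  | [], x => x
  | b :: w, x => fun n => Nat.casesOn n b (prepend w x)

theorem prepend_append (v w : List Bool) (x : Cantor) :
    prepend (v ++ w) x = prepend v (prepend w x) := by
  induction v with
  | nil => rfl
  | cons b v ih => simp only [List.cons_append, prepend, ih]

theorem prepend_cons_inj {b c : Bool} {v w : List Bool} {x y : Cantor}
    (h : prepend (b :: v) x = prepend (c :: w) y) : b = c ∧ prepend v x = prepend w y :=
  ⟨congrFun h 0, funext fun n => congrFun h (n + 1)⟩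

theorem eq_of_prepend : (v w : List Bool) → (∀ x, prepend v x = prepend w x) → v = w
  | [], [], _ => rfl
  | [], c :: w, h => by
    have := congrFun (h fun _ => !c) 0
    simp [prepend] at this
  | b :: v, [], h => by
    have := congrFun (h fun _ => !b) 0
    simp [prepend] at this
  | b :: v, c :: w, h => by
    rw [(prepend_cons_inj (h fun _ => true)).1,
      eq_of_prepend v w fun x => (prepend_cons_inj (h x)).2]

/-- `g` is described by the tree diagram `(t, s)`: it maps the `k`-th standard dyadic interval of
`s` onto the `k`-th standard dyadic interval of `t` by exchanging the two prefixes. The leaves of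
`s` and `t` correspond to each other through the order isomorphism `e`. -/
def Realizes (g : Cantor ≃ₜ Cantor) (t s : BinTree) (e : s.Leaf ≃o t.Leaf) : Prop :=
  ∀ (i : s.Leaf) (x : Cantor), g (prepend (s.word i) x) = prepend (t.word (e i)) x

namespace Realizes

theorem one : Realizes 1 .leaf .leaf (OrderIso.refl _) := fun _ _ => rfl

theorem inv {g : Cantor ≃ₜ Cantor} {t s : BinTree} {e : s.Leaf ≃o t.Leaf} (h : Realizes g t s e) :
    Realizes g⁻¹ s t e.symm := by
  intro i x
  obtain ⟨i, rfl⟩ := e.surjective i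
  rw [← h, e.symm_apply_apply]
  exact g.symm_apply_apply _

theorem mul {g h : Cantor ≃ₜ Cantor} {t s r : BinTree} {e : s.Leaf ≃o t.Leaf}
    {e' : r.Leaf ≃o s.Leaf} (hg : Realizes g t s e) (hh : Realizes h s r e') :
    Realizes (g * h) t r (e'.trans e) := by
  intro i x
  change g (h _) = _
  rw [hh, hg]
  rfl

theorem graft {g : Cantor ≃ₜ Cantor} {t s : BinTree} {e : s.Leaf ≃o t.Leaf} (h : Realizes g t s e)
    (f : t.Leaf → BinTree)
    {e' : (BinTree.graft s (fun i => f (e i))).Leaf ≃o (BinTree.graft t f).Leaf}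
    (he' : ∀ i j, e' (BinTree.graftLeaf s (fun i => f (e i)) i j) =
      BinTree.graftLeaf t f (e i) j) :
    Realizes g (BinTree.graft t f) (BinTree.graft s (fun i => f (e i))) e' := by
  intro k x
  obtain ⟨i, j, rfl⟩ := BinTree.graftLeaf_surjective _ _ k
  rw [he', BinTree.word_graftLeaf, BinTree.word_graftLeaf, prepend_append, prepend_append, h]

theorem refine {g : Cantor ≃ₜ Cantor} {t s : BinTree} {e : s.Leaf ≃o t.Leaf}
    (h : Realizes g t s e) {w : BinTree} (hw : s ≤ w) :
    ∃ (t' : BinTree) (e' : w.Leaf ≃o t'.Leaf), Realizes g t' w e' := by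
  obtain ⟨f, rfl⟩ := BinTree.exists_eq_graft s w hw
  obtain ⟨f, rfl⟩ : ∃ f' : t.Leaf → BinTree, f = fun i => f' (e i) :=
    ⟨fun j => f (e.symm j), by simp⟩
  obtain ⟨e', he'⟩ := BinTree.exists_graftIso e f
  exact ⟨_, e', h.graft f he'⟩

end Realizes

/-- Thompson's group `F`, acting on the Cantor space: the homeomorphisms that are described by
some tree diagram, with leaves matched from left to right. -/
def thompsonF : Subgroup (Cantor ≃ₜ Cantor) where
  carrier := {g | ∃ (t s : BinTree) (e : s.Leaf ≃o t.Leaf), Realizes g t s e}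
  one_mem' := ⟨_, _, _, Realizes.one⟩
  inv_mem' := fun ⟨_, _, _, h⟩ => ⟨_, _, _, h.inv⟩
  mul_mem' := by
    rintro g h ⟨t, s, e, hg⟩ ⟨s', r, e', hh⟩
    obtain ⟨t1, e1, hg1⟩ := hg.refine (BinTree.le_union_left s s')
    obtain ⟨r1, e2, hh1⟩ := hh.inv.refine (BinTree.le_union_right s s')
    have hh2 := hh1.inv
    rw [inv_inv] at hh2
    exact ⟨_, _, _, hg1.mul hh2⟩

/-- A Pythagorean pair of bounded operators on a complex Hilbert space: `A* A + B* B = 1`. -/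
structure PythagoreanPair (H : Type*) [NormedAddCommGroup H] [InnerProductSpace ℂ H]
    [CompleteSpace H] where
  A : H →L[ℂ] H
  B : H →L[ℂ] H
  pythagorean : ContinuousLinearMap.adjoint A * A + ContinuousLinearMap.adjoint B * B = 1

/-- The Hilbert space of decorations of the leaves of `t` by vectors of `H`, with inner product
the sum over the leaves. -/
abbrev Decoration (H : Type*) [NormedAddCommGroup H] [InnerProductSpace ℂ H] (t : BinTree) :
    Type _ :=
  PiLp 2 fun _ : t.Leaf => H

namespace PythagoreanPair

variable {H : Type*} [NormedAddCommGroup H] [InnerProductSpace ℂ H] [CompleteSpace H]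
  (P : PythagoreanPair H)

/-- A sequence of operators is an increasing sequence of words in `A, B`: its `n`-th term is
`x (n-1) * ... * x 1 * x 0`. -/
def word (x : ℕ → H →L[ℂ] H) : ℕ → H →L[ℂ] H
  | 0 => 1
  | n + 1 => x n * word x n

/-- The pair is diffuse if every increasing sequence of words in `A, B` tends strongly to `0`. -/
def IsDiffuse : Prop :=
  ∀ x : ℕ → H →L[ℂ] H, (∀ n, x n = P.A ∨ x n = P.B) →
    ∀ ξ : H, Filter.Tendsto (fun n => word x n ξ) Filter.atTop (nhds 0)

/-- Given a decoration of the leaves of `t`, decorate the leaves of a larger tree `s`: whenever a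
caret is attached at a leaf decorated by `ξ`, its two leaves are decorated by `A ξ` and `B ξ`.
(If `t` is not a rooted subtree of `s`, the value is irrelevant.) -/
def grow : (s t : BinTree) → (t.Leaf → H) → s.Leaf → H
  | .leaf, .leaf, ξ, .root => ξ .root
  | .leaf, .node _ _, _, _ => 0
  | .node l _, .leaf, ξ, .left i => grow l .leaf (fun _ => P.A (ξ .root)) i
  | .node _ r, .leaf, ξ, .right j => grow r .leaf (fun _ => P.B (ξ .root)) j
  | .node l _, .node l' _, ξ, .left i => grow l l' (fun i => ξ (.left i)) i
  | .node _ r, .node _ r', ξ, .right j => grow r r' (fun j => ξ (.right j)) j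

theorem grow_add : (s t : BinTree) → (ξ η : t.Leaf → H) → (i : s.Leaf) →
    P.grow s t (fun j => ξ j + η j) i = P.grow s t ξ i + P.grow s t η i
  | .leaf, .leaf, _, _, .root => rfl
  | .leaf, .node _ _, _, _, _ => (add_zero 0).symm
  | .node l _, .leaf, ξ, η, .left i => by simp only [grow, map_add]; exact grow_add l _ _ _ i
  | .node _ r, .leaf, ξ, η, .right j => by simp only [grow, map_add]; exact grow_add r _ _ _ j
  | .node l _, .node l' _, _, _, .left i => grow_add l l' _ _ i
  | .node _ r, .node _ r', _, _, .right j => grow_add r r' _ _ j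

theorem grow_smul : (s t : BinTree) → (c : ℂ) → (ξ : t.Leaf → H) → (i : s.Leaf) →
    P.grow s t (fun j => c • ξ j) i = c • P.grow s t ξ i
  | .leaf, .leaf, _, _, .root => rfl
  | .leaf, .node _ _, c, _, _ => (smul_zero c).symm
  | .node l _, .leaf, c, ξ, .left i => by simp only [grow, map_smul]; exact grow_smul l _ _ _ i
  | .node _ r, .leaf, c, ξ, .right j => by simp only [grow, map_smul]; exact grow_smul r _ _ _ j
  | .node l _, .node l' _, _, _, .left i => grow_smul l l' _ _ i
  | .node _ r, .node _ r', _, _, .right j => grow_smul r r' _ _ j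

theorem grow_self : (t : BinTree) → (ξ : t.Leaf → H) → (i : t.Leaf) → P.grow t t ξ i = ξ i
  | .leaf, _, .root => rfl
  | .node l _, _, .left i => grow_self l _ i
  | .node _ r, _, .right j => grow_self r _ j

theorem grow_grow : (r s t : BinTree) → t ≤ s → s ≤ r → (ξ : t.Leaf → H) → (i : r.Leaf) →
    P.grow r s (P.grow s t ξ) i = P.grow r t ξ i
  | .leaf, .leaf, .leaf, _, _, _, .root => rfl
  | .node _ _, .leaf, .leaf, _, _, _, .left _ => rfl
  | .node _ _, .leaf, .leaf, _, _, _, .right _ => rfl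
  | .node l _, .node l' _, .leaf, _, h, _, .left i => grow_grow l l' .leaf trivial h.1 _ i
  | .node _ r, .node _ r', .leaf, _, h, _, .right j => grow_grow r r' .leaf trivial h.2 _ j
  | .node l _, .node l' _, .node l'' _, h, h', _, .left i => grow_grow l l' l'' h.1 h'.1 _ i
  | .node _ r, .node _ r', .node _ r'', h, h', _, .right j => grow_grow r r' r'' h.2 h'.2 _ j

theorem inner_add_inner (ξ η : H) :
    inner ℂ (P.A ξ) (P.A η) + inner ℂ (P.B ξ) (P.B η) = inner ℂ ξ η := by
  rw [← ContinuousLinearMap.adjoint_inner_right, ← ContinuousLinearMap.adjoint_inner_right,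
    ← inner_add_right]
  exact congrArg (inner ℂ ξ) (congrArg (fun T : H →L[ℂ] H => T η) P.pythagorean)

theorem sum_inner_grow : (s t : BinTree) → t ≤ s → (ξ η : t.Leaf → H) →
    ∑ i, inner ℂ (P.grow s t ξ i) (P.grow s t η i) = ∑ i, inner ℂ (ξ i) (η i)
  | .leaf, .leaf, _, _, _ => by
    rw [BinTree.sum_leaf, BinTree.sum_leaf]
    rfl
  | .node l r, .leaf, _, ξ, η => by
    rw [BinTree.sum_node, BinTree.sum_leaf]
    have h1 := sum_inner_grow l .leaf trivial (fun _ => P.A (ξ .root)) (fun _ => P.A (η .root))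
    have h2 := sum_inner_grow r .leaf trivial (fun _ => P.B (ξ .root)) (fun _ => P.B (η .root))
    rw [BinTree.sum_leaf] at h1 h2
    refine (congrArg₂ (· + ·) h1 h2).trans ?_
    exact P.inner_add_inner _ _
  | .node l r, .node l' r', h, ξ, η => by
    rw [BinTree.sum_node, BinTree.sum_node]
    exact congrArg₂ (· + ·) (sum_inner_grow l l' h.1 _ _) (sum_inner_grow r r' h.2 _ _)

theorem grow_graft : (t : BinTree) → (f : t.Leaf → BinTree) → (ξ : t.Leaf → H) → (i : t.Leaf) →
    (j : (f i).Leaf) → P.grow (t.graft f) t ξ (t.graftLeaf f i j) =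
      P.grow (f i) .leaf (fun _ => ξ i) j
  | .leaf, f, _, .root, j =>
    congrArg (fun ζ => P.grow (f .root) .leaf ζ j) (funext fun | .root => rfl)
  | .node l _, f, _, .left i, j => grow_graft l (fun i => f (.left i)) _ i j
  | .node _ r, f, _, .right i, j => grow_graft r (fun i => f (.right i)) _ i j

/-- The connecting map between the spaces of decorations of `t` and `s`, where `t ≤ s`. -/
def transition (t s : BinTree) (_ : t ≤ s) : Decoration H t →ₗ[ℂ] Decoration H s where
  toFun ξ := WithLp.toLp 2 (P.grow s t ξ)
  map_add' ξ η := PiLp.ext fun i => P.grow_add s t ξ η i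
  map_smul' c ξ := PiLp.ext fun i => P.grow_smul s t c ξ i

theorem inner_transition {t s : BinTree} (h : t ≤ s) (ξ η : Decoration H t) :
    inner ℂ (P.transition t s h ξ) (P.transition t s h η) = inner ℂ ξ η := by
  rw [PiLp.inner_apply, PiLp.inner_apply]
  exact P.sum_inner_grow s t h ξ η

instance : DirectedSystem (Decoration H) (P.transition · · ·) where
  map_self t ξ := PiLp.ext fun i => P.grow_self t ξ i
  map_map r s t h h' ξ := PiLp.ext fun i => P.grow_grow r s t h h' ξ i

/-- The algebraic direct limit of the spaces of decorations, over the directed set of trees. -/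
def PreSpace : Type _ := DirectLimit (Decoration H) P.transition

noncomputable instance : AddCommGroup P.PreSpace :=
  inferInstanceAs (AddCommGroup (DirectLimit (Decoration H) P.transition))

noncomputable instance : Module ℂ P.PreSpace :=
  inferInstanceAs (Module ℂ (DirectLimit (Decoration H) P.transition))

/-- The class `[t, ξ]` of a decorated tree. -/
noncomputable def cls (t : BinTree) : Decoration H t →ₗ[ℂ] P.PreSpace :=
  DirectLimit.Module.of ℂ BinTree (Decoration H) P.transition t

theorem cls_transition {t s : BinTree} (h : t ≤ s) (ξ : Decoration H t) :
    P.cls s (P.transition t s h ξ) = P.cls t ξ :=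
  DirectLimit.Module.of_f (R := ℂ) (f := P.transition)

theorem exists_eq_cls (x : P.PreSpace) : ∃ t ξ, x = P.cls t ξ :=
  DirectLimit.exists_eq_mk P.transition x

theorem exists_eq_cls₂ (x y : P.PreSpace) : ∃ t ξ η, x = P.cls t ξ ∧ y = P.cls t η :=
  DirectLimit.exists_eq_mk₂ P.transition x y

theorem exists_eq_cls₃ (x y z : P.PreSpace) :
    ∃ t ξ η ζ, x = P.cls t ξ ∧ y = P.cls t η ∧ z = P.cls t ζ :=
  DirectLimit.exists_eq_mk₃ P.transition x y z

noncomputable instance : Inner ℂ P.PreSpace where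
  inner := DirectLimit.lift₂ P.transition P.transition (fun _ ξ η => inner ℂ ξ η)
    fun _ _ h ξ η => (P.inner_transition h ξ η).symm

theorem inner_cls (t : BinTree) (ξ η : Decoration H t) :
    inner ℂ (P.cls t ξ) (P.cls t η) = inner ℂ ξ η :=
  DirectLimit.lift₂_def P.transition P.transition _ _ t ξ η

/-- The inner product of the direct limit, which extends those of the spaces of decorations. -/
@[reducible]
noncomputable def core : InnerProductSpace.Core ℂ P.PreSpace where
  conj_inner_symm x y := by
    obtain ⟨t, ξ, η, rfl, rfl⟩ := P.exists_eq_cls₂ x y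
    rw [inner_cls, inner_cls, inner_conj_symm]
  re_inner_nonneg x := by
    obtain ⟨t, ξ, rfl⟩ := P.exists_eq_cls x
    rw [inner_cls]
    exact inner_self_nonneg
  add_left x y z := by
    obtain ⟨t, ξ, η, ζ, rfl, rfl, rfl⟩ := P.exists_eq_cls₃ x y z
    rw [← map_add, inner_cls, inner_cls, inner_cls, inner_add_left]
  smul_left x y c := by
    obtain ⟨t, ξ, η, rfl, rfl⟩ := P.exists_eq_cls₂ x y
    rw [← map_smul, inner_cls, inner_cls, inner_smul_left]
  definite x h := by
    obtain ⟨t, ξ, rfl⟩ := P.exists_eq_cls x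
    rw [inner_cls, inner_self_eq_zero] at h
    rw [h, map_zero]

noncomputable instance : NormedAddCommGroup P.PreSpace :=
  @InnerProductSpace.Core.toNormedAddCommGroup ℂ P.PreSpace _ _ _ P.core

noncomputable instance : InnerProductSpace ℂ P.PreSpace :=
  InnerProductSpace.ofCore P.core.toCore

/-- The Hilbert space of the Pythagorean representation: the completion of the direct limit. -/
abbrev Space : Type _ := UniformSpace.Completion P.PreSpace

end PythagoreanPair

/-- A unitary representation of a (discrete) group on a complex inner product space. -/
abbrev UnitaryRep (G E : Type*) [Group G] [NormedAddCommGroup E] [InnerProductSpace ℂ E] :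
    Type _ :=
  G →* (E ≃ₗᵢ[ℂ] E)

namespace UnitaryRep

/-- A unitary representation on a pre-Hilbert space extends to its completion. -/
noncomputable def completion {G E : Type*} [Group G] [NormedAddCommGroup E]
    [InnerProductSpace ℂ E] (σ : UnitaryRep G E) :
    UnitaryRep G (UniformSpace.Completion E) := by
  let T : G → UniformSpace.Completion E →L[ℂ] UniformSpace.Completion E := fun g =>
    ((σ g).toContinuousLinearEquiv : E →L[ℂ] E).completion
  have hT : ∀ g (x : E), T g x = (σ g x : E) := fun g x =>
    ContinuousLinearMap.completion_apply_coe _ x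
  have hone : ∀ x, T 1 x = x := fun x => by
    induction x using UniformSpace.Completion.induction_on with
    | hp => exact isClosed_eq (T 1).continuous continuous_id
    | ih x => rw [hT, map_one]; rfl
  have hmul : ∀ g h x, T (g * h) x = T g (T h x) := fun g h x => by
    induction x using UniformSpace.Completion.induction_on with
    | hp => exact isClosed_eq (T _).continuous ((T g).continuous.comp (T h).continuous)
    | ih x => rw [hT, hT, hT, map_mul]; rfl
  have hnorm : ∀ g x, ‖T g x‖ = ‖x‖ := fun g x => by
    induction x using UniformSpace.Completion.induction_on with
    | hp => exact isClosed_eq (T g).continuous.norm continuous_norm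
    | ih x => rw [hT, UniformSpace.Completion.norm_coe, UniformSpace.Completion.norm_coe,
        LinearIsometryEquiv.norm_map]
  exact
    { toFun := fun g =>
        { toFun := T g
          map_add' := map_add (T g)
          map_smul' := map_smul (T g)
          invFun := T g⁻¹
          left_inv := fun x => by rw [← hmul, inv_mul_cancel, hone]
          right_inv := fun x => by rw [← hmul, mul_inv_cancel, hone]
          norm_map' := hnorm g }
      map_one' := LinearIsometryEquiv.ext hone
      map_mul' := fun g h => LinearIsometryEquiv.ext (hmul g h) }

theorem completion_apply_coe {G E : Type*} [Group G] [NormedAddCommGroup E]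
    [InnerProductSpace ℂ E] (σ : UnitaryRep G E) (g : G) (x : E) :
    σ.completion g (x : UniformSpace.Completion E) = (σ g x : E) :=
  ContinuousLinearMap.completion_apply_coe _ x

/-- `π` is contained in `σ`: it is unitarily equivalent to the restriction of `σ` to a closed
invariant subspace, i.e. there is an equivariant isometry. -/
def IsContained {G E E' : Type*} [Group G] [NormedAddCommGroup E] [InnerProductSpace ℂ E]
    [NormedAddCommGroup E'] [InnerProductSpace ℂ E'] (π : UnitaryRep G E) (σ : UnitaryRep G E') :
    Prop :=
  ∃ V : E →ₗᵢ[ℂ] E', ∀ (g : G) (x : E), V (π g x) = σ g (V x)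

section Ind

variable {G : Type*} [Group G] (K : Subgroup G) {E : Type*} [NormedAddCommGroup E]
  [InnerProductSpace ℂ E] (θ : UnitaryRep K E)

/-- For the system of representatives `c.out` of the cosets `c ∈ G ⧸ K`, the element `β` of `K`
such that `g * c.out = (g • c).out * β`. -/
noncomputable def indCocycle (g : G) (c : G ⧸ K) : K :=
  ⟨(g • c).out⁻¹ * (g * c.out), by
    rw [← QuotientGroup.eq, QuotientGroup.out_eq', ← smul_eq_mul, MulAction.Quotient.coe_smul_out]⟩

theorem out_mul_indCocycle (g : G) (c : G ⧸ K) :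
    (g • c).out * (indCocycle K g c : G) = g * c.out := by
  simp [indCocycle]

theorem indCocycle_mul (g h : G) (c : G ⧸ K) :
    indCocycle K (g * h) c = indCocycle K g (h • c) * indCocycle K h c := by
  apply Subtype.ext
  apply mul_left_cancel (a := ((g * h) • c).out)
  rw [out_mul_indCocycle, mul_smul, Subgroup.coe_mul, ← mul_assoc, out_mul_indCocycle, mul_assoc,
    mul_assoc, out_mul_indCocycle]

theorem indCocycle_one (c : G ⧸ K) : indCocycle K 1 c = 1 := by
  have := indCocycle_mul K 1 1 c
  rw [one_smul, one_mul] at this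
  exact mul_eq_left.1 this.symm

theorem ind_memℓp (g : G) (f : lp (fun _ : G ⧸ K => E) 2) :
    Memℓp (fun c : G ⧸ K => θ (indCocycle K g⁻¹ c)⁻¹ (f (g⁻¹ • c))) 2 := by
  have h2 : 0 < (2 : ENNReal).toReal := by norm_num
  rw [memℓp_gen_iff h2]
  simp only [LinearIsometryEquiv.norm_map]
  exact (MulAction.toPerm g⁻¹ : Equiv.Perm (G ⧸ K)).summable_iff.2
    ((memℓp_gen_iff h2).1 (lp.memℓp f))

/-- The induced representation on `ℓ²(G ⧸ K, E)`. -/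
noncomputable def ind : UnitaryRep G (lp (fun _ : G ⧸ K => E) 2) := by
  let T : G → lp (fun _ : G ⧸ K => E) 2 → lp (fun _ : G ⧸ K => E) 2 := fun g f =>
    ⟨fun c => θ (indCocycle K g⁻¹ c)⁻¹ (f (g⁻¹ • c)), ind_memℓp K θ g f⟩
  have hone : ∀ f, T 1 f = f := fun f => lp.ext <| funext fun c => by
    change θ (indCocycle K 1⁻¹ c)⁻¹ (f ((1 : G)⁻¹ • c)) = f c
    rw [inv_one, one_smul, indCocycle_one, inv_one, map_one]
    rfl
  have hmul : ∀ g h f, T (g * h) f = T g (T h f) := fun g h f => lp.ext <| funext fun c => by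
    change θ (indCocycle K (g * h)⁻¹ c)⁻¹ (f ((g * h)⁻¹ • c)) =
      θ (indCocycle K g⁻¹ c)⁻¹ (θ (indCocycle K h⁻¹ (g⁻¹ • c))⁻¹ (f (h⁻¹ • g⁻¹ • c)))
    rw [mul_inv_rev, indCocycle_mul, mul_inv_rev, map_mul, mul_smul]
    rfl
  exact
    { toFun := fun g =>
        { toFun := T g
          map_add' := fun f f' => lp.ext <| funext fun c => map_add _ _ _
          map_smul' := fun a f => lp.ext <| funext fun c => map_smul _ _ _
          invFun := T g⁻¹
          left_inv := fun f => by rw [← hmul, inv_mul_cancel, hone]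
          right_inv := fun f => by rw [← hmul, mul_inv_cancel, hone]
          norm_map' := fun f => by
            have h2 : 0 < (2 : ENNReal).toReal := by norm_num
            change ‖T g f‖ = ‖f‖
            rw [lp.norm_eq_tsum_rpow h2, lp.norm_eq_tsum_rpow h2]
            congr 1
            refine Eq.trans ?_ ((MulAction.toPerm g⁻¹ : Equiv.Perm (G ⧸ K)).tsum_eq
              fun c => ‖f c‖ ^ (2 : ENNReal).toReal)
            exact tsum_congr fun c => congrArg (· ^ (2 : ENNReal).toReal)
              (LinearIsometryEquiv.norm_map _ _) }
      map_one' := LinearIsometryEquiv.ext hone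
      map_mul' := fun g h => LinearIsometryEquiv.ext (hmul g h) }

theorem ind_apply (g : G) (f : lp (fun _ : G ⧸ K => E) 2) (c : G ⧸ K) :
    ind K θ g f c = θ (indCocycle K g⁻¹ c)⁻¹ (f (g⁻¹ • c)) :=
  rfl

end Ind

/-- `σ` is Ind-mixing if it contains no representation that is induced from a non-zero
finite-dimensional unitary representation of a non-trivial subgroup. -/
def IsIndMixing.{u, v, w} {G : Type u} [Group G] {E : Type v} [NormedAddCommGroup E]
    [InnerProductSpace ℂ E] (σ : UnitaryRep G E) : Prop :=
  ∀ K : Subgroup G, K ≠ ⊥ →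
    ∀ (L : Type w) [NormedAddCommGroup L] [InnerProductSpace ℂ L] [FiniteDimensional ℂ L]
      [Nontrivial L] (θ : UnitaryRep K L), ¬ IsContained (ind K θ) σ

end UnitaryRep

/-- Replace the tree `s` by the tree `t`, keeping the decoration of corresponding leaves. -/
noncomputable def relabel {H : Type*} [NormedAddCommGroup H] [InnerProductSpace ℂ H]
    {t s : BinTree} (e : s.Leaf ≃o t.Leaf) :
    Decoration H s ≃ₗᵢ[ℂ] Decoration H t :=
  LinearIsometryEquiv.piLpCongrLeft 2 ℂ H e.toEquiv

theorem relabel_apply {H : Type*} [NormedAddCommGroup H] [InnerProductSpace ℂ H] {t s : BinTree}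
    (e : s.Leaf ≃o t.Leaf) (ξ : Decoration H s) (j : t.Leaf) :
    relabel e ξ j = ξ (e.symm j) :=
  rfl

namespace PythagoreanPair

variable {H : Type*} [NormedAddCommGroup H] [InnerProductSpace ℂ H] [CompleteSpace H]
  (P : PythagoreanPair H)

theorem cls_relabel_congr {g : Cantor ≃ₜ Cantor} {s t t' : BinTree} {e : s.Leaf ≃o t.Leaf}
    {e' : s.Leaf ≃o t'.Leaf} (h : Realizes g t s e) (h' : Realizes g t' s e')
    (ξ : Decoration H s) : P.cls t (relabel e ξ) = P.cls t' (relabel e' ξ) := by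
  have hw : ∀ i, t.word (e i) = t'.word (e' i) := fun i =>
    eq_of_prepend _ _ fun x => by rw [← h i x, ← h' i x]
  obtain rfl : t = t' := BinTree.eq_of_word t t' (fun j => e' (e.symm j)) (fun j => e (e'.symm j))
    (fun j => by rw [← hw, e.apply_symm_apply]) (fun j => by rw [hw, e'.apply_symm_apply])
  obtain rfl : e = e' := DFunLike.ext _ _ fun i => BinTree.word_injective t (hw i)
  rfl

theorem cls_relabel_of_le {g : Cantor ≃ₜ Cantor} {s t s' t' : BinTree} {e : s.Leaf ≃o t.Leaf}
    {e' : s'.Leaf ≃o t'.Leaf} (h : Realizes g t s e) (h' : Realizes g t' s' e') (hs : s ≤ s')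
    (ξ : Decoration H s) :
    P.cls t (relabel e ξ) = P.cls t' (relabel e' (P.transition s s' hs ξ)) := by
  obtain ⟨f, rfl⟩ := BinTree.exists_eq_graft s s' hs
  obtain ⟨f, rfl⟩ : ∃ f' : t.Leaf → BinTree, f = fun i => f' (e i) :=
    ⟨fun j => f (e.symm j), by simp⟩
  obtain ⟨d, hd⟩ := BinTree.exists_graftIso e f
  rw [P.cls_relabel_congr h' (h.graft f hd), ← P.cls_transition (BinTree.le_graft t f)]
  congr 1
  refine PiLp.ext fun k => ?_
  obtain ⟨i, j, rfl⟩ := BinTree.graftLeaf_surjective t f k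
  obtain ⟨i, rfl⟩ := e.surjective i
  rw [relabel_apply, ← hd, d.symm_apply_apply]
  change P.grow _ _ _ _ = P.grow _ _ _ _
  rw [hd, grow_graft, P.grow_graft s, relabel_apply, e.symm_apply_apply]

theorem cls_relabel_eq {g : Cantor ≃ₜ Cantor} {r s t s' t' : BinTree} {e : s.Leaf ≃o t.Leaf}
    {e' : s'.Leaf ≃o t'.Leaf} (h : Realizes g t s e) (h' : Realizes g t' s' e') (hs : r ≤ s)
    (hs' : r ≤ s') (ξ : Decoration H r) :
    P.cls t (relabel e (P.transition r s hs ξ)) =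
      P.cls t' (relabel e' (P.transition r s' hs' ξ)) := by
  obtain ⟨t₁, e₁, h₁⟩ := h.refine (BinTree.le_union_left s s')
  rw [P.cls_relabel_of_le h h₁ (BinTree.le_union_left s s'),
    P.cls_relabel_of_le h' h₁ (BinTree.le_union_right s s'),
    DirectedSystem.map_map' P.transition, DirectedSystem.map_map' P.transition]

theorem exists_realizes (g : thompsonF) (r : BinTree) :
    ∃ (s t : BinTree) (e : s.Leaf ≃o t.Leaf), r ≤ s ∧ Realizes g t s e := by
  obtain ⟨t, s, e, h⟩ := g.2
  obtain ⟨t', e', h'⟩ := h.refine (BinTree.le_union_left s r)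
  exact ⟨_, t', e', BinTree.le_union_right s r, h'⟩

/-- The Jones action on the direct limit: to apply `g` to `[r, ξ]`, choose a tree diagram `(t, s)`
of `g` with `r ≤ s`, write `[r, ξ] = [s, ξ']`, and take `[t, ξ']`. -/
noncomputable def jonesAction (g : thompsonF) : P.PreSpace →ₗ[ℂ] P.PreSpace :=
  DirectLimit.Module.lift ℂ BinTree (Decoration H) P.transition
    (fun r =>
      let s := (exists_realizes g r).choose
      let t := (exists_realizes g r).choose_spec.choose
      let e : s.Leaf ≃o t.Leaf := (exists_realizes g r).choose_spec.choose_spec.choose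
      have hs : r ≤ s := (exists_realizes g r).choose_spec.choose_spec.choose_spec.1
      P.cls t ∘ₗ (relabel e).toLinearEquiv.toLinearMap ∘ₗ P.transition r s hs)
    (fun r r' hr ξ => by
      have h' := (exists_realizes g r').choose_spec.choose_spec.choose_spec
      have h := (exists_realizes g r).choose_spec.choose_spec.choose_spec
      refine Eq.trans ?_ (P.cls_relabel_eq h'.2 h.2 (hr.trans h'.1) h.1 ξ)
      exact congrArg (fun η => P.cls _ (relabel _ η))
        (DirectedSystem.map_map' P.transition hr h'.1 ξ))

theorem jonesAction_cls (g : thompsonF) {t s : BinTree} {e : s.Leaf ≃o t.Leaf}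
    (h : Realizes g t s e) (ξ : Decoration H s) :
    P.jonesAction g (P.cls s ξ) = P.cls t (relabel e ξ) := by
  have h' := (exists_realizes g s).choose_spec.choose_spec.choose_spec
  exact (P.cls_relabel_of_le h h'.2 h'.1 ξ).symm

theorem jonesAction_one (x : P.PreSpace) : P.jonesAction 1 x = x := by
  obtain ⟨t, ξ, rfl⟩ := P.exists_eq_cls x
  exact P.jonesAction_cls 1 (e := OrderIso.refl _) (fun _ _ => rfl) ξ

theorem jonesAction_mul (g h : thompsonF) (x : P.PreSpace) :
    P.jonesAction (g * h) x = P.jonesAction g (P.jonesAction h x) := by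
  obtain ⟨r, ξ, rfl⟩ := P.exists_eq_cls x
  obtain ⟨s, t, e, hrs, hh⟩ := exists_realizes h r
  obtain ⟨s', t', e', hts, hg⟩ := exists_realizes g t
  obtain ⟨q, d, hd⟩ := hh.inv.refine hts
  have hd' : Realizes (h : Cantor ≃ₜ Cantor) s' q d.symm := by simpa using hd.inv
  have key : ∃ η, P.cls r ξ = P.cls q η := by
    have h1 : P.cls r ξ = P.jonesAction h⁻¹ (P.cls t (relabel e (P.transition r s hrs ξ))) := by
      rw [P.jonesAction_cls h⁻¹ hh.inv, ← P.cls_transition hrs]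
      congr 1
      exact PiLp.ext fun i => by rw [relabel_apply, relabel_apply]; simp
    exact ⟨_, by rw [h1, ← P.cls_transition hts, P.jonesAction_cls h⁻¹ hd]⟩
  obtain ⟨η, hη⟩ := key
  rw [hη, P.jonesAction_cls h hd', P.jonesAction_cls g hg,
    P.jonesAction_cls (g * h) (hg.mul hd')]
  rfl

theorem norm_jonesAction (g : thompsonF) (x : P.PreSpace) : ‖P.jonesAction g x‖ = ‖x‖ := by
  obtain ⟨r, ξ, rfl⟩ := P.exists_eq_cls x
  obtain ⟨s, t, e, hrs, hg⟩ := exists_realizes g r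
  rw [← P.cls_transition hrs, P.jonesAction_cls g hg, @norm_eq_sqrt_re_inner ℂ,
    @norm_eq_sqrt_re_inner ℂ _ _ _ _ (P.cls s _), inner_cls, inner_cls,
    LinearIsometryEquiv.inner_map_map]

/-- The Jones action on the direct limit, as a unitary representation. -/
noncomputable def preRep : UnitaryRep thompsonF P.PreSpace where
  toFun g :=
    { P.jonesAction g with
      invFun := P.jonesAction g⁻¹
      left_inv := fun x => by
        change P.jonesAction g⁻¹ (P.jonesAction g x) = x
        rw [← jonesAction_mul, inv_mul_cancel, jonesAction_one]
      right_inv := fun x => by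
        change P.jonesAction g (P.jonesAction g⁻¹ x) = x
        rw [← jonesAction_mul, mul_inv_cancel, jonesAction_one]
      norm_map' := P.norm_jonesAction g }
  map_one' := LinearIsometryEquiv.ext P.jonesAction_one
  map_mul' g h := LinearIsometryEquiv.ext (P.jonesAction_mul g h)

/-- The Pythagorean representation of Thompson's group `F` associated to `(A, B)`. -/
noncomputable def rep : UnitaryRep thompsonF P.Space :=
  P.preRep.completion

/-- The defining formula: if `g` is described by the tree diagram `(t, s)`, then
`σ(g) [s, ξ] = [t, ξ]`. -/
theorem rep_apply_cls (g : thompsonF) {t s : BinTree} {e : s.Leaf ≃o t.Leaf}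
    (h : Realizes g t s e) (ξ : Decoration H s) :
    P.rep g (P.cls s ξ : P.PreSpace) = (P.cls t (relabel e ξ) : P.PreSpace) :=
  (P.preRep.completion_apply_coe g _).trans
    (congrArg (fun y : P.PreSpace => (y : P.Space)) (P.jonesAction_cls g h ξ))

end PythagoreanPair

universe u w

/-!
Restricting a vector `x` of the Pythagorean representation to the sequences that start with `0` or
with `1`, and rescaling, gives two contractions `R₀`, `R₁` with `‖R₀ x‖² + ‖R₁ x‖² = ‖x‖²` (they are
the adjoints of the generators of a representation of the Cuntz algebra `𝒪₂`). For a finite word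
`w` let `R_w` be the corresponding composition, the first letter being applied first. An element `g`
of `F` with `g(ω y) = ν y` for all `y` satisfies `R_ν σ(g) = R_ω`
(`PythagoreanPair.restrict_rep`), and diffuseness says that `R_w x → 0` as `w` runs through the
prefixes of an infinite sequence (`PythagoreanPair.IsDiffuse.tendsto_restrict_take`).

Two consequences carry the argument.

* The generator `g : 00x ↦ 0x, 01x ↦ 10x, 1x ↦ 11x` has no eigenvector: from `σ(g) x = μ x` one gets
  `R₀ (R₀ x) = μ R₀ x` and `R₁ (R₁ x) = μ⁻¹ R₁ x` with `|μ| = 1`, so the norms of `R₀ⁿ x` and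
  `R₁ⁿ x` are constant for `n ≥ 1`, and they tend to zero
  (`PythagoreanPair.IsDiffuse.exists_rep_no_eigenvector`).
* The copy `g_w` of `g` that acts on the cone of `w` only satisfies `R_w σ(g_w) = σ(g) R_w`, and it
  moves `x` by at most `2 ‖R_w x‖` (`PythagoreanPair.exists_restrict_rep`).

Suppose now that `Ind_K^F θ` is contained in `σ`, and let `x ≠ 0` be the image of a vector supported
on the trivial coset. Some infinite sequence has `R_w x ≠ 0` for all its prefixes `w`, and for long
`w` the element `g_w` moves `x` by less than `‖x‖`. An element outside `K` moves `x` to a vector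
supported on another coset, hence by at least `‖x‖`. So `g_w ∈ K`, and `g_w` preserves the copy of
the space of `θ` at the trivial coset. The image of that copy under `R_w` is finite-dimensional,
nonzero and invariant under `σ(g)`, so it contains an eigenvector of `σ(g)`, a contradiction.
-/

open Filter Topology

/-! ### Restriction of vectors to cones of the Cantor space -/

namespace BinTree

/-- The subtree below the child `b` of the root; a tree without carets is its own child. -/
def child : Bool → BinTree → BinTree
  | _, leaf => leaf
  | false, node l _ => l
  | true, node _ r => r

theorem child_mono (b : Bool) : {t s : BinTree} → t ≤ s → child b t ≤ child b s
  | leaf, leaf, _ => le_refl leaf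
  | leaf, node _ _, _ => by cases b <;> trivial
  | node _ _, node _ _, h => by
    cases b
    · exact h.1
    · exact h.2

end BinTree

namespace PythagoreanPair

variable {H : Type*} [NormedAddCommGroup H] [InnerProductSpace ℂ H] [CompleteSpace H]
  (P : PythagoreanPair H)

/-- The operator attached to an edge: `A` for a left edge and `B` for a right edge. -/
def edgeOp : Bool → H →L[ℂ] H
  | false => P.A
  | true => P.B

/-- The decoration that a decoration of `t` induces on the subtree below the child `b` of the
root, where a caret is first attached to the root if `t` has none. -/
def descend : (b : Bool) → (t : BinTree) → Decoration H t →ₗ[ℂ] Decoration H (t.child b)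
  | b, .leaf =>
    { toFun := fun ξ => WithLp.toLp 2 fun _ => P.edgeOp b (ξ .root)
      map_add' := fun _ _ => PiLp.ext fun _ => map_add _ _ _
      map_smul' := fun _ _ => PiLp.ext fun _ => map_smul _ _ _ }
  | false, .node _ _ =>
    { toFun := fun ξ => WithLp.toLp 2 fun i => ξ (.left i)
      map_add' := fun _ _ => rfl
      map_smul' := fun _ _ => rfl }
  | true, .node _ _ =>
    { toFun := fun ξ => WithLp.toLp 2 fun i => ξ (.right i)
      map_add' := fun _ _ => rfl
      map_smul' := fun _ _ => rfl }

theorem transition_descend (b : Bool) : {t s : BinTree} → (h : t ≤ s) → (ξ : Decoration H t) →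
    P.transition _ _ (BinTree.child_mono b h) (P.descend b t ξ) =
      P.descend b s (P.transition t s h ξ)
  | .leaf, .leaf, _, _ => PiLp.ext fun .root => rfl
  | .leaf, .node _ _, _, _ => by cases b <;> rfl
  | .node _ _, .node _ _, _, _ => by cases b <;> rfl

/-- The restriction of a class of decorated trees to the half `b` of the Cantor space. -/
noncomputable def preRestrict (b : Bool) : P.PreSpace →ₗ[ℂ] P.PreSpace :=
  DirectLimit.Module.lift ℂ BinTree (Decoration H) P.transition
    (fun t => P.cls (t.child b) ∘ₗ P.descend b t)
    (fun t s h ξ => by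
      change P.cls _ (P.descend b s (P.transition t s h ξ)) = P.cls _ (P.descend b t ξ)
      rw [← P.transition_descend b h, P.cls_transition])

theorem preRestrict_cls (b : Bool) (t : BinTree) (ξ : Decoration H t) :
    P.preRestrict b (P.cls t ξ) = P.cls (t.child b) (P.descend b t ξ) :=
  rfl

theorem inner_preRestrict (x y : P.PreSpace) :
    inner ℂ (P.preRestrict false x) (P.preRestrict false y) +
      inner ℂ (P.preRestrict true x) (P.preRestrict true y) = inner ℂ x y := by
  obtain ⟨t, ξ, η, rfl, rfl⟩ := P.exists_eq_cls₂ x y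
  simp only [preRestrict_cls, inner_cls, PiLp.inner_apply]
  cases t with
  | leaf =>
    simp only [BinTree.sum_leaf]
    refine (congrArg₂ (· + ·) (BinTree.sum_leaf _) (BinTree.sum_leaf _)).trans ?_
    exact P.inner_add_inner _ _
  | node l r =>
    rw [BinTree.sum_node]
    rfl

theorem norm_sq_preRestrict (x : P.PreSpace) :
    ‖P.preRestrict false x‖ ^ 2 + ‖P.preRestrict true x‖ ^ 2 = ‖x‖ ^ 2 := by
  have h := congrArg RCLike.re (P.inner_preRestrict x x)
  simpa only [map_add, inner_self_eq_norm_sq] using h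

theorem norm_preRestrict_le (b : Bool) (x : P.PreSpace) : ‖P.preRestrict b x‖ ≤ ‖x‖ := by
  have h := P.norm_sq_preRestrict x
  cases b <;> refine (sq_le_sq₀ (norm_nonneg _) (norm_nonneg _)).1 ?_ <;>
    nlinarith [sq_nonneg ‖P.preRestrict false x‖, sq_nonneg ‖P.preRestrict true x‖]

/-- The restriction of a vector to the half `b` of the Cantor space, rescaled to the whole Cantor
space. The two operators are the adjoints of the isometries of a representation of the Cuntz
algebra `𝒪₂`. -/
noncomputable def halfRestrict (b : Bool) : P.Space →L[ℂ] P.Space :=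
  ((P.preRestrict b).mkContinuous 1 fun x => by
    rw [one_mul]; exact P.norm_preRestrict_le b x).completion

theorem halfRestrict_coe (b : Bool) (x : P.PreSpace) :
    P.halfRestrict b (x : P.Space) = (P.preRestrict b x : P.PreSpace) :=
  ContinuousLinearMap.completion_apply_coe _ x

theorem norm_sq_halfRestrict (x : P.Space) :
    ‖P.halfRestrict false x‖ ^ 2 + ‖P.halfRestrict true x‖ ^ 2 = ‖x‖ ^ 2 := by
  induction x using UniformSpace.Completion.induction_on with
  | hp => exact isClosed_eq (by fun_prop) (by fun_prop)
  | ih x =>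
    simp only [halfRestrict_coe, UniformSpace.Completion.norm_coe]
    exact P.norm_sq_preRestrict x

theorem ext_halfRestrict {x y : P.Space} (h : ∀ b, P.halfRestrict b x = P.halfRestrict b y) :
    x = y := by
  have h' := P.norm_sq_halfRestrict (x - y)
  simp only [map_sub, h, sub_self, norm_zero] at h'
  exact sub_eq_zero.1 (norm_eq_zero.1 (pow_eq_zero_iff two_ne_zero |>.1 (by linarith)))

theorem norm_halfRestrict_le (b : Bool) (x : P.Space) : ‖P.halfRestrict b x‖ ≤ ‖x‖ := by
  have h := P.norm_sq_halfRestrict x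
  cases b <;> refine (sq_le_sq₀ (norm_nonneg _) (norm_nonneg _)).1 ?_ <;>
    nlinarith [sq_nonneg ‖P.halfRestrict false x‖, sq_nonneg ‖P.halfRestrict true x‖]

/-- The restriction of a vector to the cone of the sequences with prefix `w`, rescaled to the whole
Cantor space. -/
noncomputable def restrict : List Bool → P.Space →L[ℂ] P.Space
  | [] => ContinuousLinearMap.id ℂ _
  | b :: w => restrict w ∘L P.halfRestrict b

theorem restrict_cons (b : Bool) (w : List Bool) (x : P.Space) :
    P.restrict (b :: w) x = P.restrict w (P.halfRestrict b x) :=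
  rfl

theorem restrict_append (v w : List Bool) (x : P.Space) :
    P.restrict (v ++ w) x = P.restrict w (P.restrict v x) := by
  induction v generalizing x with
  | nil => rfl
  | cons b v ih => exact ih _

theorem norm_restrict_le (w : List Bool) (x : P.Space) : ‖P.restrict w x‖ ≤ ‖x‖ := by
  induction w generalizing x with
  | nil => exact le_rfl
  | cons b w ih => exact (ih _).trans (P.norm_halfRestrict_le b x)

/-- A vector is determined by its restrictions to the cones of the leaves of a tree. -/
theorem ext_restrict_word (t : BinTree) {x y : P.Space}
    (h : ∀ i, P.restrict (t.word i) x = P.restrict (t.word i) y) : x = y := by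
  induction t generalizing x y with
  | leaf => exact h .root
  | node l r hl hr =>
    refine P.ext_halfRestrict fun b => ?_
    cases b
    · exact hl fun i => h (.left i)
    · exact hr fun i => h (.right i)

theorem restrict_word_cls_graft : (t : BinTree) → (f : t.Leaf → BinTree) →
    (ξ : Decoration H (t.graft f)) → (i : t.Leaf) →
    P.restrict (t.word i) (P.cls (t.graft f) ξ : P.PreSpace) =
      (P.cls (f i) (WithLp.toLp 2 fun j => ξ (t.graftLeaf f i j)) : P.PreSpace)
  | .leaf, _, _, .root => rfl
  | .node l r, f, ξ, .left i => by
    change P.restrict (l.word i) (P.halfRestrict false _) = _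
    rw [halfRestrict_coe]
    exact restrict_word_cls_graft l (fun i => f (.left i)) _ i
  | .node l r, f, ξ, .right i => by
    change P.restrict (r.word i) (P.halfRestrict true _) = _
    rw [halfRestrict_coe]
    exact restrict_word_cls_graft r (fun i => f (.right i)) _ i

/-- Since `g` replaces the prefix `s.word i` by `t.word (e i)`, `σ(g)` carries the part of a
vector on the cone of the former to the cone of the latter, unchanged. -/
theorem restrict_rep (g : thompsonF) {t s : BinTree} {e : s.Leaf ≃o t.Leaf}
    (h : Realizes g t s e) (i : s.Leaf) (x : P.Space) :
    P.restrict (t.word (e i)) (P.rep g x) = P.restrict (s.word i) x := by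
  induction x using UniformSpace.Completion.induction_on with
  | hp =>
    have h := (P.rep g).continuous
    exact isClosed_eq (by fun_prop) (by fun_prop)
  | ih x =>
    obtain ⟨r, ξ, rfl⟩ := P.exists_eq_cls x
    rw [← P.cls_transition (BinTree.le_union_right s r)]
    generalize P.transition _ _ _ ξ = η
    generalize hq : BinTree.union s r = q at η
    obtain ⟨f, rfl⟩ := BinTree.exists_eq_graft s q (hq ▸ BinTree.le_union_left s r)
    obtain ⟨f, rfl⟩ : ∃ f' : t.Leaf → BinTree, f = fun i => f' (e i) :=
      ⟨fun j => f (e.symm j), by simp⟩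
    obtain ⟨d, hd⟩ := BinTree.exists_graftIso e f
    rw [P.rep_apply_cls g (h.graft f hd), restrict_word_cls_graft,
      P.restrict_word_cls_graft s (fun i => f (e i))]
    congr 3
    refine funext fun j => ?_
    rw [relabel_apply, ← hd, d.symm_apply_apply]

end PythagoreanPair

/-! ### Every tree diagram is realized -/

namespace BinTree

/-- Order isomorphisms between the leaves of the two halves of two trees combine to an order
isomorphism between all their leaves. -/
theorem exists_nodeIso {l l' r r' : BinTree} (e : l.Leaf ≃o l'.Leaf) (d : r.Leaf ≃o r'.Leaf) :
    ∃ e' : (node l r).Leaf ≃o (node l' r').Leaf,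
      (∀ i, e' (.left i) = .left (e i)) ∧ ∀ j, e' (.right j) = .right (d j) := by
  let φ : (node l r).Leaf → (node l' r').Leaf
    | .left i => .left (e i)
    | .right j => .right (d j)
  have hmono : StrictMono φ
    | .left i, .left j, h => e.lt_iff_lt.2 (show i < j from h)
    | .right i, .right j, h =>
      Nat.add_lt_add_left (d.lt_iff_lt.2 (show i < j from Nat.lt_of_add_lt_add_left h)) _
    | .left i, .right j, _ => Nat.lt_add_right _ (pos_lt l' (e i))
    | .right i, .left j, h => by
      have h1 := pos_lt l j
      simp only [leaf_lt_iff, pos] at h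
      omega
  have hsurj : Function.Surjective φ
    | .left i => ⟨.left (e.symm i), congrArg Leaf.left (e.apply_symm_apply i)⟩
    | .right j => ⟨.right (d.symm j), congrArg Leaf.right (d.apply_symm_apply j)⟩
  exact ⟨hmono.orderIsoOfSurjective φ hsurj, fun _ => rfl, fun _ => rfl⟩

theorem exists_prepend_word : (t : BinTree) → (x : Cantor) → ∃ i y, prepend (t.word i) y = x
  | leaf, x => ⟨.root, x, rfl⟩
  | node l r, x => by
    have key : ∀ (b : Bool) (w : List Bool) (y : Cantor), x 0 = b →
        prepend w y = (fun n => x (n + 1)) → prepend (b :: w) y = x := fun b w y hb h => funext fun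
      | 0 => hb.symm
      | n + 1 => congrFun h n
    cases hx : x 0 with
    | false =>
      obtain ⟨i, y, h⟩ := exists_prepend_word l fun n => x (n + 1)
      exact ⟨.left i, y, key _ _ _ hx h⟩
    | true =>
      obtain ⟨i, y, h⟩ := exists_prepend_word r fun n => x (n + 1)
      exact ⟨.right i, y, key _ _ _ hx h⟩

theorem prepend_word_inj : (t : BinTree) → (i j : t.Leaf) → (x y : Cantor) →
    prepend (t.word i) x = prepend (t.word j) y → i = j ∧ x = y
  | leaf, .root, .root, _, _, h => ⟨rfl, h⟩
  | node l _, .left i, .left j, x, y, h => by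
    obtain ⟨rfl, h'⟩ := prepend_word_inj l i j x y (prepend_cons_inj h).2
    exact ⟨rfl, h'⟩
  | node _ r, .right i, .right j, x, y, h => by
    obtain ⟨rfl, h'⟩ := prepend_word_inj r i j x y (prepend_cons_inj h).2
    exact ⟨rfl, h'⟩
  | node _ _, .left _, .right _, _, _, h => absurd (prepend_cons_inj h).1 Bool.false_ne_true
  | node _ _, .right _, .left _, _, _, h => absurd (prepend_cons_inj h).1.symm Bool.false_ne_true

end BinTree

theorem continuous_prepend (w : List Bool) : Continuous (prepend w) := by
  induction w with
  | nil => exact continuous_id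
  | cons b w ih =>
    refine continuous_pi fun n => ?_
    cases n with
    | zero => exact continuous_const
    | succ n => exact (continuous_apply n).comp ih

/-- Every tree diagram describes an element of Thompson's group. -/
theorem exists_thompsonF_realizes {t s : BinTree} (e : s.Leaf ≃o t.Leaf) :
    ∃ g : thompsonF, Realizes g t s e := by
  let _ (t : BinTree) : TopologicalSpace t.Leaf := ⊥
  have _ (t : BinTree) : DiscreteTopology t.Leaf := ⟨rfl⟩
  -- The leaves of a tree cut the Cantor space into finitely many copies of itself.
  have hΦ : ∀ t : BinTree, ∃ Φ : t.Leaf × Cantor ≃ₜ Cantor,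
      ∀ i x, Φ (i, x) = prepend (t.word i) x := by
    intro t
    let φ : t.Leaf × Cantor → Cantor := fun p => prepend (t.word p.1) p.2
    have hφ : Function.Bijective φ :=
      ⟨fun p q h => Prod.ext_iff.2 (t.prepend_word_inj _ _ _ _ h), fun x => by
        obtain ⟨i, y, h⟩ := t.exists_prepend_word x
        exact ⟨(i, y), h⟩⟩
    have hc : Continuous (Equiv.ofBijective φ hφ) :=
      continuous_prod_of_discrete_left.2 fun i => continuous_prepend (t.word i)
    exact ⟨hc.homeoOfEquivCompactToT2, fun _ _ => rfl⟩
  obtain ⟨Φ, hΦt⟩ := hΦ t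
  obtain ⟨Ψ, hΨs⟩ := hΦ s
  let E : s.Leaf ≃ₜ t.Leaf := e.toEquiv.toHomeomorphOfDiscrete
  let g : Cantor ≃ₜ Cantor := (Ψ.symm.trans (E.prodCongr (.refl _))).trans Φ
  have hg : Realizes g t s e := fun i x => by
    change Φ (Prod.map e id (Ψ.symm (prepend (s.word i) x))) = _
    rw [← hΨs, Ψ.symm_apply_apply, ← hΦt]
    rfl
  exact ⟨⟨g, t, s, e, hg⟩, hg⟩

/-! ### Elements of Thompson's group acting on a cone -/

namespace PythagoreanPair

variable {H : Type*} [NormedAddCommGroup H] [InnerProductSpace ℂ H] [CompleteSpace H]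
  (P : PythagoreanPair H)

/-- Every `g` in Thompson's group has a copy that acts on one half of the Cantor space only. -/
theorem exists_halfRestrict_rep (b : Bool) (g : thompsonF) : ∃ g' : thompsonF, ∀ x,
    P.halfRestrict b (P.rep g' x) = P.rep g (P.halfRestrict b x) ∧
      P.halfRestrict (!b) (P.rep g' x) = P.halfRestrict (!b) x := by
  obtain ⟨t, s, e, h⟩ := g.2
  cases b
  · obtain ⟨d, hl, hr⟩ := BinTree.exists_nodeIso e (OrderIso.refl BinTree.leaf.Leaf)
    obtain ⟨g', hg'⟩ := exists_thompsonF_realizes d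
    refine ⟨g', fun x => ⟨P.ext_restrict_word t fun j => ?_, ?_⟩⟩
    · obtain ⟨i, rfl⟩ := e.surjective j
      rw [P.restrict_rep g h]
      have := P.restrict_rep g' hg' (.left i) x
      rwa [hl] at this
    · have := P.restrict_rep g' hg' (.right .root) x
      rwa [hr] at this
  · obtain ⟨d, hl, hr⟩ := BinTree.exists_nodeIso (OrderIso.refl BinTree.leaf.Leaf) e
    obtain ⟨g', hg'⟩ := exists_thompsonF_realizes d
    refine ⟨g', fun x => ⟨P.ext_restrict_word t fun j => ?_, ?_⟩⟩
    · obtain ⟨i, rfl⟩ := e.surjective j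
      rw [P.restrict_rep g h]
      have := P.restrict_rep g' hg' (.right i) x
      rwa [hr] at this
    · have := P.restrict_rep g' hg' (.left .root) x
      rwa [hl] at this

/-- Every `g` in Thompson's group has a copy that acts on the cone of `w` only. It moves a vector
as far as `g` moves the restriction of that vector to the cone. -/
theorem exists_restrict_rep (w : List Bool) (g : thompsonF) : ∃ g' : thompsonF, ∀ x,
    P.restrict w (P.rep g' x) = P.rep g (P.restrict w x) ∧
      ‖P.rep g' x - x‖ = ‖P.rep g (P.restrict w x) - P.restrict w x‖ := by
  induction w with
  | nil => exact ⟨g, fun x => ⟨rfl, rfl⟩⟩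
  | cons b w ih =>
    obtain ⟨g₁, h₁⟩ := ih
    obtain ⟨g₂, h₂⟩ := P.exists_halfRestrict_rep b g₁
    refine ⟨g₂, fun x => ⟨?_, ?_⟩⟩
    · rw [restrict_cons, (h₂ x).1, (h₁ _).1, restrict_cons]
    · rw [restrict_cons, ← (h₁ (P.halfRestrict b x)).2,
        ← sq_eq_sq₀ (norm_nonneg _) (norm_nonneg _), ← P.norm_sq_halfRestrict]
      have h := h₂ x
      cases b
      · simp [map_sub, h.1, show P.halfRestrict true (P.rep g₂ x) = _ from h.2]
      · simp [map_sub, h.1, show P.halfRestrict false (P.rep g₂ x) = _ from h.2]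

/-- The standard generator `00x ↦ 0x`, `01x ↦ 10x`, `1x ↦ 11x` of Thompson's group, seen in the
Pythagorean representation. -/
theorem exists_rep_generator : ∃ g : thompsonF, ∀ x,
    P.restrict [false] (P.rep g x) = P.restrict [false, false] x ∧
      P.restrict [true, true] (P.rep g x) = P.restrict [true] x := by
  let φ : (BinTree.node (.node .leaf .leaf) .leaf).Leaf →
      (BinTree.node .leaf (.node .leaf .leaf)).Leaf
    | .left (.left .root) => .left .root
    | .left (.right .root) => .right (.left .root)
    | .right .root => .right (.right .root)
  have hmono : StrictMono φ
    | .left (.left .root), .left (.right .root), _ => Nat.one_pos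
    | .left (.left .root), .right .root, _ => Nat.two_pos
    | .left (.right .root), .right .root, _ => Nat.one_lt_two
    | .left (.left .root), .left (.left .root), h => absurd h (lt_irrefl _)
    | .left (.right .root), .left (.right .root), h => absurd h (lt_irrefl _)
    | .right .root, .right .root, h => absurd h (lt_irrefl _)
    | .left (.right .root), .left (.left .root), h => absurd (show 1 < 0 from h) (by decide)
    | .right .root, .left (.left .root), h => absurd (show 2 < 0 from h) (by decide)
    | .right .root, .left (.right .root), h => absurd (show 2 < 1 from h) (by decide)
  have hsurj : Function.Surjective φ
    | .left .root => ⟨.left (.left .root), rfl⟩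
    | .right (.left .root) => ⟨.left (.right .root), rfl⟩
    | .right (.right .root) => ⟨.right .root, rfl⟩
  obtain ⟨g, hg⟩ := exists_thompsonF_realizes (hmono.orderIsoOfSurjective φ hsurj)
  exact ⟨g, fun x => ⟨P.restrict_rep g hg (.left (.left .root)) x,
    P.restrict_rep g hg (.right .root) x⟩⟩

end PythagoreanPair

/-! ### Diffuse pairs -/

/-- The prefix of length `n` of an infinite binary sequence. -/
def Cantor.take (p : Cantor) (n : ℕ) : List Bool :=
  (List.range n).map p

theorem Cantor.take_succ (p : Cantor) (n : ℕ) : p.take (n + 1) = p.take n ++ [p n] := by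
  simp [Cantor.take, List.range_succ]

theorem Cantor.take_succ' (p : Cantor) (n : ℕ) :
    p.take (n + 1) = p 0 :: Cantor.take (fun k => p (k + 1)) n := by
  simp [Cantor.take, List.range_succ_eq_map, Function.comp_def]

namespace PythagoreanPair

variable {H : Type*} [NormedAddCommGroup H] [InnerProductSpace ℂ H] [CompleteSpace H]
  (P : PythagoreanPair H)

theorem restrict_take_cls_leaf (p : Cantor) (n : ℕ) (ξ : Decoration H .leaf) :
    P.restrict (p.take n) (P.cls .leaf ξ : P.PreSpace) =
      (P.cls .leaf (WithLp.toLp 2 fun _ => word (fun k => P.edgeOp (p k)) n (ξ .root)) :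
        P.PreSpace) := by
  induction n with
  | zero =>
    change ((P.cls .leaf ξ : P.PreSpace) : P.Space) = _
    congr 2
    exact PiLp.ext fun .root => rfl
  | succ n ih =>
    rw [Cantor.take_succ, restrict_append, ih]
    change P.halfRestrict (p n) _ = _
    rw [halfRestrict_coe, preRestrict_cls]
    rfl

variable {P}

/-- For a diffuse pair, the mass of a vector on the neighbourhoods of a point of the Cantor space
tends to zero. -/
theorem IsDiffuse.tendsto_restrict_take (hP : P.IsDiffuse) (p : Cantor) (x : P.Space) :
    Tendsto (fun n => P.restrict (p.take n) x) atTop (𝓝 0) := by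
  have hcls : ∀ (t : BinTree) (ξ : Decoration H t) (p : Cantor), Tendsto
      (fun n => P.restrict (p.take n) (P.cls t ξ : P.PreSpace)) atTop (𝓝 0) := by
    intro t
    induction t with
    | leaf =>
      intro ξ p
      rw [tendsto_zero_iff_norm_tendsto_zero]
      have h := hP (fun k => P.edgeOp (p k)) (fun k => by cases p k <;> simp [edgeOp]) (ξ .root)
      rw [tendsto_zero_iff_norm_tendsto_zero] at h
      refine h.congr fun n => ?_
      rw [restrict_take_cls_leaf, UniformSpace.Completion.norm_coe, @norm_eq_sqrt_re_inner ℂ,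
        @norm_eq_sqrt_re_inner ℂ _ _ _ _ (P.cls _ _), inner_cls, PiLp.inner_apply,
        BinTree.sum_leaf]
    | node l r hl hr =>
      intro ξ p
      rw [← tendsto_add_atTop_iff_nat 1]
      simp only [Cantor.take_succ', restrict_cons, halfRestrict_coe, preRestrict_cls]
      cases p 0
      · exact hl _ _
      · exact hr _ _
  -- The vectors `[t, ξ]` are dense and the restriction operators are contractions.
  rw [Metric.tendsto_atTop]
  intro ε hε
  obtain ⟨y, hy⟩ := Metric.denseRange_iff.1
    (UniformSpace.Completion.denseRange_coe (α := P.PreSpace)) x (ε / 2) (half_pos hε)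
  obtain ⟨t, ξ, rfl⟩ := P.exists_eq_cls y
  obtain ⟨N, hN⟩ := Metric.tendsto_atTop.1 (hcls t ξ p) (ε / 2) (half_pos hε)
  refine ⟨N, fun n hn => ?_⟩
  have h := hN n hn
  rw [dist_zero_right] at h ⊢
  rw [dist_eq_norm] at hy
  have h' := P.norm_restrict_le (p.take n) (x - (P.cls t ξ : P.PreSpace))
  rw [map_sub] at h'
  have h'' := norm_le_norm_add_norm_sub' (P.restrict (p.take n) x)
    (P.restrict (p.take n) (P.cls t ξ : P.PreSpace))
  linarith

/-- For a diffuse pair, the restriction to a half of the Cantor space has no eigenvalue on the unit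
circle. -/
theorem IsDiffuse.eq_zero_of_halfRestrict_eq_smul (hP : P.IsDiffuse) {b : Bool} {μ : ℂ}
    (hμ : ‖μ‖ = 1) {x : P.Space} (hx : P.halfRestrict b x = μ • x) : x = 0 := by
  have h : ∀ n, ‖P.restrict (Cantor.take (fun _ => b) n) x‖ = ‖x‖ := by
    intro n
    induction n with
    | zero => rfl
    | succ n ih => rw [Cantor.take_succ', restrict_cons, hx, map_smul, norm_smul, hμ, one_mul, ih]
  have h' := (hP.tendsto_restrict_take (fun _ => b) x).norm
  simp only [h, norm_zero] at h'
  exact norm_eq_zero.1 (tendsto_nhds_unique tendsto_const_nhds h')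

/-- For a diffuse pair, some element of Thompson's group has no eigenvector: the standard generator,
which shrinks the cones at one end of the Cantor space and expands them at the other. -/
theorem IsDiffuse.exists_rep_no_eigenvector (hP : P.IsDiffuse) : ∃ g : thompsonF,
    ∀ (μ : ℂ) (x : P.Space), P.rep g x = μ • x → x = 0 := by
  obtain ⟨g, hg⟩ := P.exists_rep_generator
  refine ⟨g, fun μ x hx => ?_⟩
  by_contra hx0
  have hμ : ‖μ‖ = 1 := by
    have h := (P.rep g).norm_map x
    rw [hx, norm_smul] at h
    exact (mul_eq_right₀ (norm_ne_zero_iff.2 hx0)).1 h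
  have hμ0 : μ ≠ 0 := norm_ne_zero_iff.1 (hμ ▸ one_ne_zero)
  have h := hg x
  rw [hx, map_smul, map_smul] at h
  refine hx0 (P.ext_halfRestrict fun b => ?_)
  rw [map_zero]
  cases b
  · exact hP.eq_zero_of_halfRestrict_eq_smul hμ (b := false) h.1.symm
  · refine hP.eq_zero_of_halfRestrict_eq_smul (μ := μ⁻¹) (by rw [norm_inv, hμ, inv_one])
      (b := true) ?_
    rw [eq_inv_smul_iff₀ hμ0]
    exact h.2

variable (P) in
/-- Every nonzero vector has a point in its support. -/
theorem exists_forall_restrict_take_ne_zero {x : P.Space} (hx : x ≠ 0) :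
    ∃ p : Cantor, ∀ n, P.restrict (p.take n) x ≠ 0 := by
  have hb : ∀ w, ∃ b, P.restrict w x ≠ 0 → P.restrict (w ++ [b]) x ≠ 0 := by
    intro w
    by_contra! h
    exact (h true).1 (P.ext_halfRestrict fun b => by
      rw [map_zero, ← (h b).2, restrict_append]; rfl)
  choose b hb using hb
  let W : ℕ → List Bool := fun n => Nat.rec [] (fun _ w => w ++ [b w]) n
  have hW : ∀ n, Cantor.take (fun n => b (W n)) n = W n := by
    intro n
    induction n with
    | zero => rfl
    | succ n ih => rw [Cantor.take_succ, ih]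
  refine ⟨fun n => b (W n), fun n => ?_⟩
  rw [hW]
  induction n with
  | zero => exact hx
  | succ n ih => exact hb _ ih

end PythagoreanPair

/-! ### Vectors of the induced representation supported on the trivial coset -/

namespace UnitaryRep

section Ind

variable {G : Type*} [Group G] (K : Subgroup G) {E : Type*} [NormedAddCommGroup E]
  [InnerProductSpace ℂ E] (θ : UnitaryRep K E)

open scoped Classical in
/-- The vectors of the induced representation that are supported on the trivial coset. -/
noncomputable def indSingle : E →ₗ[ℂ] lp (fun _ : G ⧸ K => E) 2 :=
  lp.lsingle (𝕜 := ℂ) (E := fun _ : G ⧸ K => E) 2 ((1 : G) : G ⧸ K)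

open scoped Classical in
theorem indSingle_apply_self (x : E) : indSingle K x ((1 : G) : G ⧸ K) = x :=
  lp.single_apply_self (E := fun _ : G ⧸ K => E) 2 _ x

open scoped Classical in
theorem indSingle_apply_ne (x : E) {c : G ⧸ K} (hc : c ≠ ((1 : G) : G ⧸ K)) :
    indSingle K x c = 0 :=
  lp.single_apply_ne (E := fun _ : G ⧸ K => E) 2 _ x hc

open scoped Classical in
theorem norm_indSingle (x : E) : ‖indSingle K x‖ = ‖x‖ :=
  lp.norm_single (E := fun _ : G ⧸ K => E) (p := 2) (by norm_num) _ x

variable {K}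

theorem inv_smul_one_eq_iff {g : G} :
    g⁻¹ • ((1 : G) : G ⧸ K) = ((1 : G) : G ⧸ K) ↔ g ∈ K := by
  rw [MulAction.Quotient.smul_coe, QuotientGroup.eq]
  simp

theorem exists_ind_indSingle {g : G} (hg : g ∈ K) (x : E) :
    ∃ y, ind K θ g (indSingle K x) = indSingle K y := by
  refine ⟨θ (indCocycle K g⁻¹ ((1 : G) : G ⧸ K))⁻¹ x, lp.ext (funext fun c => ?_)⟩
  rw [ind_apply]
  by_cases hc : c = ((1 : G) : G ⧸ K)
  · rw [hc, inv_smul_one_eq_iff.2 hg, indSingle_apply_self, indSingle_apply_self]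
  · rw [indSingle_apply_ne K _ hc, indSingle_apply_ne, map_zero]
    rwa [← inv_smul_one_eq_iff.2 hg, (MulAction.injective g⁻¹).ne_iff]

/-- Outside `K`, the induced representation moves a vector supported on the trivial coset by a
definite amount, since it carries it to another coset. -/
theorem norm_le_norm_ind_indSingle_sub {g : G} (hg : g ∉ K) (x : E) :
    ‖x‖ ≤ ‖ind K θ g (indSingle K x) - indSingle K x‖ := by
  refine le_trans (le_of_eq ?_) (lp.norm_apply_le_norm two_ne_zero _ ((1 : G) : G ⧸ K))
  rw [lp.coeFn_sub, Pi.sub_apply, ind_apply, indSingle_apply_self,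
    indSingle_apply_ne K x (mt inv_smul_one_eq_iff.1 hg), map_zero, zero_sub, norm_neg]

end Ind

end UnitaryRep

/-! ### Ind-mixing -/

theorem theoremA {H : Type u} [NormedAddCommGroup H] [InnerProductSpace ℂ H]
    [CompleteSpace H] (P : PythagoreanPair H) (hP : P.IsDiffuse) :
    UnitaryRep.IsIndMixing.{0, u, w} P.rep := by
  intro K _ L _ _ _ _ θ ⟨V, hV⟩
  obtain ⟨ξ, hξ⟩ := exists_ne (0 : L)
  have hv : V (UnitaryRep.indSingle K ξ) ≠ 0 := by
    rwa [← norm_ne_zero_iff, V.norm_map, UnitaryRep.norm_indSingle, norm_ne_zero_iff]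
  obtain ⟨p, hp⟩ := P.exists_forall_restrict_take_ne_zero hv
  obtain ⟨g, hg⟩ := hP.exists_rep_no_eigenvector
  obtain ⟨n, hn⟩ :=
    ((hP.tendsto_restrict_take p (V (UnitaryRep.indSingle K ξ))).norm.eventually_lt_const
      (show ‖(0 : P.Space)‖ < ‖ξ‖ / 2 by simpa using hξ)).exists
  obtain ⟨h, hh⟩ := P.exists_restrict_rep (p.take n) g
  -- The copy `h` of `g` on a small cone moves the vector too little to lie outside `K`.
  have hK : h ∈ K := by
    by_contra hK
    have h₁ := UnitaryRep.norm_le_norm_ind_indSingle_sub θ hK ξ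
    rw [← V.norm_map, map_sub, hV, (hh _).2] at h₁
    have h₂ := norm_sub_le (P.rep g (P.restrict (p.take n) (V (UnitaryRep.indSingle K ξ))))
      (P.restrict (p.take n) (V (UnitaryRep.indSingle K ξ)))
    rw [LinearIsometryEquiv.norm_map] at h₂
    linarith
  -- Hence the restrictions to this cone of the copy of `L` form a nonzero finite-dimensional
  -- invariant subspace for `g`, which contains an eigenvector.
  let T : L →ₗ[ℂ] P.Space :=
    (P.restrict (p.take n)).toLinearMap ∘ₗ V.toLinearMap ∘ₗ UnitaryRep.indSingle K
  have hT : ∀ x ∈ LinearMap.range T, (P.rep g).toLinearEquiv.toLinearMap x ∈ LinearMap.range T := by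
    rintro _ ⟨x, rfl⟩
    obtain ⟨y, hy⟩ := UnitaryRep.exists_ind_indSingle θ hK x
    refine ⟨y, ?_⟩
    change P.restrict _ (V (UnitaryRep.indSingle K y)) =
      P.rep g (P.restrict _ (V (UnitaryRep.indSingle K x)))
    rw [← hy, hV, (hh _).1]
  have _ : Nontrivial (LinearMap.range T) :=
    ⟨⟨⟨T ξ, ξ, rfl⟩, 0, fun h0 => hp n (congrArg Subtype.val h0)⟩⟩
  obtain ⟨μ, hμ⟩ := Module.End.exists_eigenvalue
    ((P.rep g).toLinearEquiv.toLinearMap.restrict hT)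
  obtain ⟨x, hx⟩ := hμ.exists_hasEigenvector
  exact hx.2 (Subtype.ext (hg μ x (congrArg Subtype.val hx.apply_eq_smul)))
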